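/- **Setting.** Fix a function-free relational language with constants, ordinary predicates and special unary predicates $sp$. A state is an interpretation $I$ of the language over a finite non-empty set $D$ of objects. Open expressions are decision diagrams whose inner nodes are atoms (including equality atoms) and whose leaves are non-negative reals. An action template $A(u)$ with parameters $u$ has finitely many deterministic variants $A_j(u)$, given by choice probabilities $Pr(A_j(u))$ (open expressions in $u$, summing to $1$ over $j$) and, for every predicate $p(w)$, an open expression in $u,w$ (truth value diagram) giving the truth value of $p(w)$ in the next state. $Regr(V,A_j)$ denotes the replacement of every atom of $V$ by its truth value diagram. A service domain consists of finitely many (at least one) agent action templates $A$, an exogenous template $E(i)$ with one parameter, a reward $R=\max_x\operatorname{avg}_y R(x,y)$ ($x$ a possibly empty tuple of variables, $y$ one variable), and a discount factor $0\le\gamma<1$. In each step the agent performs one ground action, and then all $E(i)$, $i\in D$, take place simultaneously and independently. We assume: $E(i)$ can change only atoms $sp(i)$; $sp$ does not occur in the probabilities and preconditions of agent actions, and occurs in those of $E(i)$ only as $sp(i)$ (the truth value diagram of $sp(w)$ may also refer to the current value of $sp(w)$); in $R(x,y)$ the predicates $sp$ occur only as $sp(y)$. **Template method.** $V_0=R$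 and $V_{m+1}=SDP^1(SDP^2(V_m))$. For $V=\max_x\operatorname{avg}_yV(x,y)$, $SDP^2(V)=\max_x\operatorname{avg}_y W(x,y)$, where $W(x,a)=\sum_j Pr(E_j(a))\,Regr(V(x,a),E_j(a))$ with the same $x$ in all summands. $SDP^1(V)$ is the symbolic backup $\max_A\max_u\big[R\oplus\gamma\otimes\bigoplus_j Pr(A_j(u))\otimes Regr(V,A_j(u))\big]$, in which all summands are standardized apart in the variables under $\max$ and share $y$, and in which the binary maximum of $\max_x\operatorname{avg}_y f^1$ and $\max_x\operatorname{avg}_y f^2$ is $\max_{z_1,z_2}\max_x\operatorname{avg}_y(\text{if }z_1=z_2\text{ then }f^1(x,y)\text{ else }f^2(x,y))$; so all results are again of the form $\max_x\operatorname{avg}_y$. **Values.** Let $V^{opt}_m$ be the optimal value with $m$ actions to go (value iteration from $R$ with exact Bellman backups) and $V^*$ the supremum over policies of the expected infinite discounted reward. Let $V^{SL}_m(I)$ be the maximum over sequences of $m$ ground actions, fixed in advance, of the expected value of $\sum_{t=0}^m\gamma^tR(s_t)$, $s_0=I$. Let $\bar V^{SL}_m(I)$ be the maximum over sequences of $m$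 ground actions together with object tuples $x_0,\dots,x_m$, all fixed in advance, of the expected value of $\sum_{t=0}^m\gamma^t\operatorname{avg}_yR(x_t,y)(s_t)$, i.e. the plan also commits to the arguments of the maximum in the reward. If the reward has no $\max$ variables, $R=\operatorname{avg}_yR(y)$, then both notions coincide. **Claim.** For every $m\ge 0$ and every state $I$ over $D$: 1. If there is only one agent action template and it is deterministic (has one variant), then $V_m(I)=\bar V^{SL}_m(I)$; in particular $V_m(I)=V^{SL}_m(I)$ if $R=\operatorname{avg}_yR(y)$. 2. In general, $\bar V^{SL}_m(I)\le V_m(I)\le V^{opt}_m(I)\le V^*(I)$, and $V^{SL}_m(I)\le V_m(I)$ if $R=\operatorname{avg}_yR(y)$; for the lower bounds it is assumed that $D$ has at least two objects if there is more than one agent action template. -/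

import Mathlib

open scoped NNReal ENNReal

/-- A function-free relational language: constants, ordinary predicates with their arities, and the
special unary predicates `sp` (the only ones that exogenous events may change). -/
structure RelSig.{u} where
  Const : Type u
  Pred : Type u
  arity : Pred → ℕ
  Sp : Type u

/-- A state: an interpretation of the language over the set of objects `D`. -/
structure Interp (L : RelSig) (D : Type*) where
  const : L.Const → D
  rel : (p : L.Pred) → (Fin (L.arity p) → D) → Prop
  sp : L.Sp → D → Prop

/-! ### Open expressions -/

inductive RTerm (L : RelSig) (V : Type*) where
  | const (c : L.Const) : RTerm L V
  | var (v : V) : RTerm L V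

namespace RTerm

variable {L : RelSig} {V W D : Type*}

def subst (σ : V → RTerm L W) : RTerm L V → RTerm L W
  | const c => const c
  | var v => σ v

def eval (I : Interp L D) (ζ : V → D) : RTerm L V → D
  | const c => I.const c
  | var v => ζ v

end RTerm

inductive RAtom (L : RelSig) (V : Type*) where
  | rel (p : L.Pred) (t : Fin (L.arity p) → RTerm L V) : RAtom L V
  | sp (q : L.Sp) (t : RTerm L V) : RAtom L V
  | eq (t₁ t₂ : RTerm L V) : RAtom L V

namespace RAtom

variable {L : RelSig} {V W D : Type*}

def subst (σ : V → RTerm L W) : RAtom L V → RAtom L W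
  | rel p t => rel p (fun i => (t i).subst σ)
  | sp q t => sp q (t.subst σ)
  | eq t₁ t₂ => eq (t₁.subst σ) (t₂.subst σ)

def Holds (I : Interp L D) (ζ : V → D) : RAtom L V → Prop
  | rel p t => I.rel p (fun i => (t i).eval I ζ)
  | sp q t => I.sp q (t.eval I ζ)
  | eq t₁ t₂ => t₁.eval I ζ = t₂.eval I ζ

/-- If the atom is built from a special predicate, then its argument is a variable in `S`. -/
def SpOnly (S : Set V) : RAtom L V → Prop
  | rel _ _ => True
  | sp _ t => ∃ v ∈ S, t = RTerm.var v
  | eq _ _ => True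

end RAtom

/-- Decision diagrams (unfolded into trees) with inner nodes labelled by atoms over the variables
`V` and leaves labelled by elements of `α`; the first child is the true branch. -/
inductive Diagram (L : RelSig) (V : Type*) (α : Type*) where
  | leaf (a : α) : Diagram L V α
  | node (A : RAtom L V) (hi lo : Diagram L V α) : Diagram L V α

namespace Diagram

variable {L : RelSig} {V W D α β δ : Type*}

open Classical in
/-- The leaf reached in the interpretation `I` under the substitution `ζ`. -/
noncomputable def eval (I : Interp L D) (ζ : V → D) : Diagram L V α → α
  | leaf a => a
  | node A hi lo => if A.Holds I ζ then hi.eval I ζ else lo.eval I ζ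

def subst (σ : V → RTerm L W) : Diagram L V α → Diagram L W α
  | leaf a => leaf a
  | node A hi lo => node (A.subst σ) (hi.subst σ) (lo.subst σ)

def rename (σ : V → W) (f : Diagram L V α) : Diagram L W α :=
  f.subst (fun v => RTerm.var (σ v))

def map (g : α → β) : Diagram L V α → Diagram L V β
  | leaf a => leaf (g a)
  | node A hi lo => node A (hi.map g) (lo.map g)

/-- The binary operation `op` applied to two open expressions. -/
def apply (op : α → β → δ) : Diagram L V α → Diagram L V β → Diagram L V δ
  | leaf a, g => g.map (op a)
  | node A hi lo, g => node A (hi.apply op g) (lo.apply op g)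

/-- Hang `hi` below the true leaves and `lo` below the false leaves. -/
def graft (hi lo : Diagram L V α) : Diagram L V Bool → Diagram L V α
  | leaf b => if b then hi else lo
  | node A f g => node A (graft hi lo f) (graft hi lo g)

/-- Block replacement of every atom `A` by the diagram `T A`. -/
def replace (T : RAtom L V → Diagram L V Bool) : Diagram L V α → Diagram L V α
  | leaf a => leaf a
  | node A hi lo => graft (hi.replace T) (lo.replace T) (T A)

/-- The special predicates appear in the diagram only applied to variables in `S`. -/
def SpOnly (S : Set V) : Diagram L V α → Prop
  | leaf _ => True
  | node A hi lo => A.SpOnly S ∧ hi.SpOnly S ∧ lo.SpOnly S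

end Diagram

/-! ### Action templates -/

/-- An action template with `p` parameters: a finite number of deterministic variants, each with
its choice probability (an open expression in the parameters) and its truth value diagrams: for
every predicate, its truth value in the next state as an open expression in the action parameters
(`Sum.inl`) and the arguments of the predicate (`Sum.inr`). -/
structure ActionTemplate (L : RelSig) (p : ℕ) where
  numVariants : ℕ
  prob : Fin numVariants → Diagram L (Fin p) ℝ≥0
  tvd : Fin numVariants → (r : L.Pred) → Diagram L (Fin p ⊕ Fin (L.arity r)) Bool
  tvdSp : Fin numVariants → L.Sp → Diagram L (Fin p ⊕ Unit) Bool

namespace ActionTemplate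

variable {L : RelSig} {p : ℕ} {V D α : Type*}

/-- The probability that variant `j` is chosen when the action is performed on the objects `a`. -/
noncomputable def probAt (A : ActionTemplate L p) (j : Fin A.numVariants) (a : Fin p → D)
    (I : Interp L D) : ℝ≥0 :=
  (A.prob j).eval I a

/-- The state after executing variant `j` on the objects `a`. -/
noncomputable def next (A : ActionTemplate L p) (j : Fin A.numVariants) (a : Fin p → D)
    (I : Interp L D) : Interp L D where
  const := I.const
  rel r d := (A.tvd j r).eval I (Sum.elim a d) = true
  sp q d := (A.tvdSp j q).eval I (Sum.elim a (fun _ => d)) = true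

/-- The truth value diagram of an atom under variant `j` of the action with arguments `args`. -/
def atomTVD (A : ActionTemplate L p) (j : Fin A.numVariants) (args : Fin p → RTerm L V) :
    RAtom L V → Diagram L V Bool
  | .rel r t => (A.tvd j r).subst (Sum.elim args t)
  | .sp q t => (A.tvdSp j q).subst (Sum.elim args (fun _ => t))
  | .eq t₁ t₂ => .node (.eq t₁ t₂) (.leaf true) (.leaf false)

/-- Regression of an open expression over variant `j` of the action with arguments `args`. -/
def regress (A : ActionTemplate L p) (j : Fin A.numVariants) (args : Fin p → RTerm L V)
    (f : Diagram L V α) : Diagram L V α :=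
  f.replace (A.atomTVD j args)

end ActionTemplate

/-! ### Expressions with aggregation `max_x avg_y` -/

/-- Variables of an expression with `p` free variables (action parameters or a Skolem constant),
`k` variables under `max` and one variable `y` under `avg`. -/
inductive AggVar (p k : ℕ) where
  | free (i : Fin p) : AggVar p k
  | mx (i : Fin k) : AggVar p k
  | av : AggVar p k

namespace AggVar

def map {p p' k k' : ℕ} (g : Fin p → Fin p') (h : Fin k → Fin k') : AggVar p k → AggVar p' k'
  | free i => free (g i)
  | mx i => mx (h i)
  | av => av

def assign {D : Type*} {p k : ℕ} (a : Fin p → D) (x : Fin k → D) (y : D) : AggVar p k → D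
  | free i => a i
  | mx i => x i
  | av => y

end AggVar

/-- The expression `max_x avg_y V(x,y)`, where `x` has `k` components, with `p` free variables. -/
structure MaxAvg (L : RelSig) (p : ℕ) where
  k : ℕ
  body : Diagram L (AggVar p k) ℝ≥0

namespace MaxAvg

variable {L : RelSig} {p : ℕ} {D : Type*}

/-- `avg_y V(x,y)` for fixed objects `x`. -/
noncomputable def avgAt [Fintype D] (V : MaxAvg L p) (a : Fin p → D) (x : Fin V.k → D)
    (I : Interp L D) : ℝ≥0 :=
  (∑ y : D, V.body.eval I (AggVar.assign a x y)) / (Fintype.card D : ℝ≥0)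

noncomputable def eval [Fintype D] (V : MaxAvg L p) (a : Fin p → D) (I : Interp L D) : ℝ≥0 :=
  ⨆ x : Fin V.k → D, V.avgAt a x I

/-- The value of a closed expression. -/
noncomputable def value [Fintype D] (V : MaxAvg L 0) (I : Interp L D) : ℝ≥0 :=
  V.eval Fin.elim0 I

def zero : MaxAvg L p := ⟨0, .leaf 0⟩

def scale (c : ℝ≥0) (V : MaxAvg L p) : MaxAvg L p := ⟨V.k, V.body.map (fun v => c * v)⟩

/-- Addition of expressions: the `max` variables are standardized apart, `y` is shared. -/
def add (V W : MaxAvg L p) : MaxAvg L p :=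
  ⟨V.k + W.k,
    (V.body.rename (AggVar.map id (Fin.castAdd W.k))).apply (fun v w => v + w)
      (W.body.rename (AggVar.map id (Fin.natAdd V.k)))⟩

/-- The binary maximum: `max_{z₁,z₂} max_x avg_y (if z₁ = z₂ then V(x,y) else W(x,y))`, where the
two expressions share their variables. -/
def max (V W : MaxAvg L p) : MaxAvg L p :=
  ⟨2 + Nat.max V.k W.k,
    .node (.eq (.var (.mx (Fin.castAdd _ 0))) (.var (.mx (Fin.castAdd _ 1))))
      (V.body.rename (AggVar.map id (fun i => Fin.natAdd 2 (Fin.castLE (Nat.le_max_left _ _) i))))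
      (W.body.rename
        (AggVar.map id (fun i => Fin.natAdd 2 (Fin.castLE (Nat.le_max_right _ _) i))))⟩

/-- Maximum of the expressions `Q 0, …, Q n`. -/
def maxAll : (n : ℕ) → (Fin (n + 1) → MaxAvg L p) → MaxAvg L p
  | 0, Q => Q 0
  | n + 1, Q => (Q 0).max (maxAll n (fun i => Q i.succ))

/-- View a closed expression as one with `p` free variables. -/
def lift (V : MaxAvg L 0) : MaxAvg L p := ⟨V.k, V.body.rename (AggVar.map Fin.elim0 id)⟩

/-- Object maximization: the free variables become variables under `max`. -/
def objMax (V : MaxAvg L p) : MaxAvg L 0 :=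
  ⟨p + V.k, V.body.rename fun v => match v with
    | .free i => .mx (Fin.castAdd V.k i)
    | .mx i => .mx (Fin.natAdd p i)
    | .av => .av⟩

end MaxAvg

/-! ### Service domains and the template method -/

/-- A relational MDP with exogenous events: agent action templates (at least one, indexed by
`Fin (n + 1)`), the exogenous action template `E(i)`, the reward, and the discount factor. -/
structure ServiceDomain (L : RelSig) where
  n : ℕ
  params : Fin (n + 1) → ℕ
  agent : (t : Fin (n + 1)) → ActionTemplate L (params t)
  exo : ActionTemplate L 1
  reward : MaxAvg L 0
  γ : ℝ≥0

namespace ServiceDomain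

variable {L : RelSig} (M : ServiceDomain L)

/-- `Pr(A_j) ⊗ Regr(V, A_j)` for the template `t`, with the action parameters free. -/
def regressVariant (V : MaxAvg L 0) (t : Fin (M.n + 1)) (j : Fin (M.agent t).numVariants) :
    MaxAvg L (M.params t) :=
  ⟨V.k, ((M.agent t).prob j).rename AggVar.free |>.apply (fun v w => v * w)
    ((M.agent t).regress j (fun i => .var (.free i)) (V.lift (p := M.params t)).body)⟩

/-- `R ⊕ γ ⊗ ⨁_j (Pr(A_j) ⊗ Regr(V, A_j))`, all summands standardized apart. -/
def qFun (V : MaxAvg L 0) (t : Fin (M.n + 1)) : MaxAvg L (M.params t) :=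
  M.reward.lift.add (MaxAvg.scale M.γ
    ((List.ofFn (fun j => M.regressVariant V t j)).foldr MaxAvg.add MaxAvg.zero))

/-- The symbolic Bellman backup for agent actions. -/
def sdp1 (V : MaxAvg L 0) : MaxAvg L 0 :=
  MaxAvg.maxAll M.n (fun t => (M.qFun V t).objMax)

/-- The open expression `V(x,a)` obtained by replacing `y` by a Skolem constant `a` (written as the
free variable). -/
def ground (V : MaxAvg L 0) : Diagram L (AggVar 1 V.k) ℝ≥0 :=
  V.body.rename fun v => match v with
    | .free i => i.elim0
    | .mx i => .mx i
    | .av => .free 0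

/-- `⨁_j (Pr(E_j(a)) ⊗ Regr(V(x,a), E_j(a)))`, without standardizing apart. -/
def exoSum (V : MaxAvg L 0) : Diagram L (AggVar 1 V.k) ℝ≥0 :=
  (List.ofFn (fun j => ((M.exo.prob j).rename AggVar.free).apply (fun v w => v * w)
    (M.exo.regress j (fun i => .var (.free i)) (ground V)))).foldr
      (fun f g => f.apply (fun v w => v + w) g) (.leaf 0)

/-- The template step for exogenous events: ground, regress, add the variants, and lift back to
`max_x avg_y W(x,y)`. -/
def sdp2 (V : MaxAvg L 0) : MaxAvg L 0 :=
  ⟨V.k, (M.exoSum V).rename fun v => match v with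
    | .free _ => .av
    | .mx i => .mx i
    | .av => .av⟩

/-- The expressions computed by the template method: `V₀ = R`, `V_{m+1} = SDP¹(SDP²(V_m))`. -/
def template : ℕ → MaxAvg L 0
  | 0 => M.reward
  | m + 1 => M.sdp1 (M.sdp2 (template m))

/-! ### Semantics of the MDP over the objects `D` -/

section Semantics

variable (D : Type*)

/-- A concrete agent action: a template with objects for its parameters. -/
abbrev GroundAction : Type _ := Σ t : Fin (M.n + 1), (Fin (M.params t) → D)

variable {D}

/-- The state after the exogenous actions have taken place simultaneously, where variant `β i` of
`E(i)` occurred: the atoms `sp(i)` are set by `E(i)`, everything else is unchanged. -/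
noncomputable def exoNext (β : D → Fin M.exo.numVariants) (I : Interp L D) : Interp L D where
  const := I.const
  rel := I.rel
  sp q i := (M.exo.next (β i) (fun _ => i) I).sp q i

variable [Fintype D]

open Classical in
/-- Expectation of `f` after the simultaneous, independent exogenous actions. -/
noncomputable def exoExpect (f : Interp L D → ℝ≥0) (I : Interp L D) : ℝ≥0 :=
  ∑ β : D → Fin M.exo.numVariants,
    (∏ i : D, M.exo.probAt (β i) (fun _ => i) I) * f (M.exoNext β I)

/-- Expectation of `f` over the next state: first the agent's action, then the exogenous ones. -/
noncomputable def expect (a : M.GroundAction D) (f : Interp L D → ℝ≥0) (I : Interp L D) : ℝ≥0 :=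
  ∑ j : Fin (M.agent a.1).numVariants,
    (M.agent a.1).probAt j a.2 I * M.exoExpect f ((M.agent a.1).next j a.2 I)

/-- Optimal value with `m` steps to go (value iteration with exact Bellman backups). -/
noncomputable def optValue : ℕ → Interp L D → ℝ≥0
  | 0, I => M.reward.value I
  | m + 1, I => ⨆ a : M.GroundAction D, M.reward.value I + M.γ * M.expect a (optValue m) I

/-- Expected reward at time `t` when the (possibly time-dependent) policy `π` is followed. -/
noncomputable def rewardAt : ℕ → (ℕ → Interp L D → M.GroundAction D) → Interp L D → ℝ≥0
  | 0, _, I => M.reward.value I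
  | t + 1, π, I => M.expect (π 0 I) (rewardAt t (fun i => π (i + 1))) I

/-- The optimal value function: the supremum over policies of the expected discounted total
reward. -/
noncomputable def optimalValue (I : Interp L D) : ℝ≥0∞ :=
  ⨆ π : ℕ → Interp L D → M.GroundAction D, ∑' t : ℕ, ((M.γ ^ t * M.rewardAt t π I : ℝ≥0) : ℝ≥0∞)

/-- Expected discounted total of the rewards `r 0, …, r m` when the fixed sequence of ground
actions `plan` is executed. -/
noncomputable def planValue : (m : ℕ) → (Fin (m + 1) → Interp L D → ℝ≥0) →
    (Fin m → M.GroundAction D) → Interp L D → ℝ≥0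
  | 0, r, _, I => r 0 I
  | m + 1, r, plan, I =>
    r 0 I + M.γ * M.expect (plan 0) (planValue m (fun i => r i.succ) (fun i => plan i.succ)) I

/-- Value of the best straight-line plan with `m` actions. -/
noncomputable def slValue (m : ℕ) (I : Interp L D) : ℝ≥0 :=
  ⨆ plan : Fin m → M.GroundAction D, M.planValue m (fun _ => M.reward.value) plan I

/-- Value of the best straight-line plan with `m` actions, when the plan also fixes in advance, for
every time, the objects bound to the `max` variables of the reward `max_x avg_y R(x,y)`. -/
noncomputable def slArgValue (m : ℕ) (I : Interp L D) : ℝ≥0 :=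
  ⨆ plan : Fin m → M.GroundAction D, ⨆ x : Fin (m + 1) → (Fin M.reward.k → D),
    M.planValue m (fun t => M.reward.avgAt Fin.elim0 (x t)) plan I

end Semantics

/-! ### Assumptions -/

/-- The choice probabilities of the variants of every action sum to one. -/
structure Stochastic (D : Type*) : Prop where
  agent : ∀ (t : Fin (M.n + 1)) (a : Fin (M.params t) → D) (I : Interp L D),
    ∑ j, (M.agent t).probAt j a I = 1
  exo : ∀ (i : D) (I : Interp L D), ∑ j, M.exo.probAt j (fun _ => i) I = 1

/-- `E(i)` can only change the special unary properties of the object `i`. -/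
structure ExoLocal (D : Type*) : Prop where
  rel : ∀ (j : Fin M.exo.numVariants) (i : D) (I : Interp L D),
    (M.exo.next j (fun _ => i) I).rel = I.rel
  sp : ∀ (j : Fin M.exo.numVariants) (i : D) (I : Interp L D) (q : L.Sp) (d : D), d ≠ i →
    ((M.exo.next j (fun _ => i) I).sp q d ↔ I.sp q d)

/-- `sp` does not appear in the preconditions of agent actions, and appears in those of `E(i)` only
as `sp(i)`. The truth value diagram of `sp(y)` itself may also refer to the current `sp(y)`. -/
structure SpPreconditions : Prop where
  agentProb : ∀ t j, ((M.agent t).prob j).SpOnly ∅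
  agentRel : ∀ t j r, ((M.agent t).tvd j r).SpOnly ∅
  agentSp : ∀ t j q, ((M.agent t).tvdSp j q).SpOnly {Sum.inr ()}
  exoProb : ∀ j, (M.exo.prob j).SpOnly {0}
  exoRel : ∀ j r, (M.exo.tvd j r).SpOnly {Sum.inl 0}
  exoSp : ∀ j q, (M.exo.tvdSp j q).SpOnly {Sum.inl 0, Sum.inr ()}

/-- In the reward `max_x avg_y R(x,y)` the special predicates appear only as `sp(y)`. -/
def RewardForm : Prop := M.reward.body.SpOnly {AggVar.av}

/-- There is only one agent action template, and it is deterministic. -/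
def SingleDeterministic : Prop := M.n = 0 ∧ ∀ t, (M.agent t).numVariants = 1

end ServiceDomain

/-! ### Evaluation of open expressions -/

namespace Diagram

variable {L : RelSig} {V W D α β δ : Type*}

/-! Once the objects `z` for the `max` variables of `V_m` are fixed, `avgAt z` is a function of the
state alone, and the theorem follows from what such an instance means.

The exogenous step is exact on instances (`avgAt_sdp2`). Expectation commutes with the average over
`y`. For a fixed `y` the body sees the special predicates only as `sp(y)`, and in the next state
these are set by `E(y)` alone. All other independent events therefore sum out, leaving the
single-object regression over `E(y)`. This needs the invariant that `sp` occurs in every `V_m` only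
as `sp(y)` (`spOnly_template`).

An instance of the agent step is a ground action, objects for the current reward, and one instance
of the regressed expression for each variant, since the summands are standardized apart
(`exists_avgAt_of_sdp1`, with converse `exists_sdp1_avgAt_eq`). So an instance of `V_m` is a plan
that may branch on the variant of its own actions, but not on exogenous outcomes.

Straight-line plans with fixed reward arguments are the instances that ignore the variant, which
gives the lower bound. With a single deterministic template there are no others, which gives
equality. Re-choosing the instance in every state can only increase the expectation, so `V_m` is at
most `optValue`. The latter is attained by a greedy policy, whose further rewards are nonnegative,
and this bounds it by `optimalValue`. -/

theorem _root_.RTerm.eval_subst (I : Interp L D) (ζ : W → D) (σ : V → RTerm L W) (t : RTerm L V) :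
    (t.subst σ).eval I ζ = t.eval I (fun v => (σ v).eval I ζ) := by
  cases t <;> rfl

theorem _root_.RAtom.holds_subst (I : Interp L D) (ζ : W → D) (σ : V → RTerm L W)
    (A : RAtom L V) :
    (A.subst σ).Holds I ζ ↔ A.Holds I (fun v => (σ v).eval I ζ) := by
  cases A <;> simp [RAtom.subst, RAtom.Holds, RTerm.eval_subst]

theorem eval_subst (I : Interp L D) (ζ : W → D) (σ : V → RTerm L W) (f : Diagram L V α) :
    (f.subst σ).eval I ζ = f.eval I (fun v => (σ v).eval I ζ) := by
  induction f with
  | leaf a => rfl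
  | node A hi lo h₁ h₂ =>
    classical exact if_congr (RAtom.holds_subst I ζ σ A) h₁ h₂

theorem eval_rename (I : Interp L D) (ζ : W → D) (σ : V → W) (f : Diagram L V α) :
    (f.rename σ).eval I ζ = f.eval I (fun v => ζ (σ v)) :=
  eval_subst I ζ _ f

theorem eval_map (I : Interp L D) (ζ : V → D) (g : α → β) (f : Diagram L V α) :
    (f.map g).eval I ζ = g (f.eval I ζ) := by
  induction f with
  | leaf a => rfl
  | node A hi lo h₁ h₂ => simp only [map, eval, h₁, h₂]; split <;> rfl

theorem eval_apply (I : Interp L D) (ζ : V → D) (op : α → β → δ) (f : Diagram L V α)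
    (g : Diagram L V β) : (f.apply op g).eval I ζ = op (f.eval I ζ) (g.eval I ζ) := by
  induction f with
  | leaf a => exact eval_map I ζ _ g
  | node A hi lo h₁ h₂ => simp only [apply, eval, h₁, h₂]; split <;> rfl

theorem eval_graft (I : Interp L D) (ζ : V → D) (hi lo : Diagram L V α) (f : Diagram L V Bool) :
    (graft hi lo f).eval I ζ = if f.eval I ζ = true then hi.eval I ζ else lo.eval I ζ := by
  induction f with
  | leaf b => cases b <;> rfl
  | node A f g h₁ h₂ => simp only [graft, eval, h₁, h₂]; split <;> rfl

theorem eval_replace {I J : Interp L D} {ζ : V → D} {T : RAtom L V → Diagram L V Bool}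
    (hT : ∀ A, (T A).eval I ζ = true ↔ A.Holds J ζ) (f : Diagram L V α) :
    (f.replace T).eval I ζ = f.eval J ζ := by
  induction f with
  | leaf a => rfl
  | node A hi lo h₁ h₂ =>
    classical exact (eval_graft I ζ _ _ _).trans (if_congr (hT A) h₁ h₂)

/-- An expression depends on the special predicates only through the atoms that it mentions. -/
theorem eval_congr_of_spOnly {I J : Interp L D} {ζ : V → D} {S : Set V} (hc : I.const = J.const)
    (hr : I.rel = J.rel) (hs : ∀ v ∈ S, ∀ q, I.sp q (ζ v) ↔ J.sp q (ζ v)) (f : Diagram L V α)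
    (hf : f.SpOnly S) : f.eval I ζ = f.eval J ζ := by
  have ht : ∀ t : RTerm L V, t.eval I ζ = t.eval J ζ := by
    intro t
    cases t <;> simp [RTerm.eval, hc]
  have hA : ∀ A : RAtom L V, A.SpOnly S → (A.Holds I ζ ↔ A.Holds J ζ) := by
    intro A h
    cases A with
    | rel p t => simp only [RAtom.Holds, hr, ht]
    | sp q t =>
      obtain ⟨v, hv, rfl⟩ := h
      exact hs v hv q
    | eq t₁ t₂ => simp only [RAtom.Holds, ht]
  induction f with
  | leaf a => rfl
  | node A hi lo h₁ h₂ =>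
    classical exact if_congr (hA A hf.1) (h₁ hf.2.1) (h₂ hf.2.2)

/-! ### Occurrences of the special predicates -/

theorem SpOnly.subst {S : Set V} {S' : Set W} {σ : V → RTerm L W}
    (hσ : ∀ v ∈ S, ∃ w ∈ S', σ v = RTerm.var w) {f : Diagram L V α} (hf : f.SpOnly S) :
    (f.subst σ).SpOnly S' := by
  induction f with
  | leaf a => trivial
  | node A hi lo h₁ h₂ =>
    refine ⟨?_, h₁ hf.2.1, h₂ hf.2.2⟩
    have hA := hf.1
    cases A with
    | rel p t => trivial
    | sp q t =>
      obtain ⟨v, hv, rfl⟩ := hA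
      exact hσ v hv
    | eq t₁ t₂ => trivial

theorem SpOnly.rename {S : Set V} {S' : Set W} {σ : V → W} (hσ : ∀ v ∈ S, σ v ∈ S')
    {f : Diagram L V α} (hf : f.SpOnly S) : (f.rename σ).SpOnly S' :=
  hf.subst fun v hv => ⟨σ v, hσ v hv, rfl⟩

theorem SpOnly.map {S : Set V} (g : α → β) {f : Diagram L V α} (hf : f.SpOnly S) :
    (f.map g).SpOnly S := by
  induction f with
  | leaf a => trivial
  | node A hi lo h₁ h₂ => exact ⟨hf.1, h₁ hf.2.1, h₂ hf.2.2⟩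

theorem SpOnly.apply {S : Set V} (op : α → β → δ) {f : Diagram L V α} {g : Diagram L V β}
    (hf : f.SpOnly S) (hg : g.SpOnly S) : (f.apply op g).SpOnly S := by
  induction f with
  | leaf a => exact hg.map _
  | node A hi lo h₁ h₂ => exact ⟨hf.1, h₁ hf.2.1, h₂ hf.2.2⟩

theorem SpOnly.graft {S : Set V} {hi lo : Diagram L V α} {f : Diagram L V Bool}
    (hhi : hi.SpOnly S) (hlo : lo.SpOnly S) (hf : f.SpOnly S) : (graft hi lo f).SpOnly S := by
  induction f with
  | leaf b => cases b <;> assumption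
  | node A f g h₁ h₂ => exact ⟨hf.1, h₁ hf.2.1, h₂ hf.2.2⟩

theorem SpOnly.replace {S S' : Set V} {T : RAtom L V → Diagram L V Bool}
    (hT : ∀ A, A.SpOnly S → (T A).SpOnly S') {f : Diagram L V α} (hf : f.SpOnly S) :
    (f.replace T).SpOnly S' := by
  induction f with
  | leaf a => trivial
  | node A hi lo h₁ h₂ => exact (h₁ hf.2.1).graft (h₂ hf.2.2) (hT A hf.1)

end Diagram

/-! ### Regression -/

namespace ActionTemplate

variable {L : RelSig} {p : ℕ} {V D α : Type*}

theorem eval_atomTVD (A : ActionTemplate L p) (j : Fin A.numVariants) (args : Fin p → RTerm L V)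
    (I : Interp L D) (ζ : V → D) (B : RAtom L V) :
    (A.atomTVD j args B).eval I ζ = true ↔
      B.Holds (A.next j (fun i => (args i).eval I ζ) I) ζ := by
  -- Actions leave the constants fixed, so terms, and with them equality atoms, keep their values.
  have ht : ∀ t : RTerm L V, t.eval (A.next j (fun i => (args i).eval I ζ) I) ζ = t.eval I ζ := by
    intro t
    cases t <;> rfl
  cases B with
  | rel r t =>
    simp only [atomTVD, Diagram.eval_subst, RAtom.Holds, ht]
    simp only [next]
    refine iff_of_eq (congrArg (fun ξ => (A.tvd j r).eval I ξ = true) ?_)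
    funext v
    cases v <;> rfl
  | sp q t =>
    simp only [atomTVD, Diagram.eval_subst, RAtom.Holds, ht]
    simp only [next]
    refine iff_of_eq (congrArg (fun ξ => (A.tvdSp j q).eval I ξ = true) ?_)
    funext v
    cases v <;> rfl
  | eq t₁ t₂ =>
    simp only [atomTVD, Diagram.eval, RAtom.Holds, ht]
    by_cases h : t₁.eval I ζ = t₂.eval I ζ <;> simp [h]

/-- The regressed expression gives the value of the expression in the next state. -/
theorem eval_regress (A : ActionTemplate L p) (j : Fin A.numVariants) (args : Fin p → RTerm L V)
    (I : Interp L D) (ζ : V → D) (f : Diagram L V α) :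
    (A.regress j args f).eval I ζ = f.eval (A.next j (fun i => (args i).eval I ζ) I) ζ :=
  Diagram.eval_replace (A.eval_atomTVD j args I ζ) f

/-- A truth value diagram introduces special atoms only on action arguments from `S₀`, or, when it
replaces `sp(t)`, on `t` itself; both lie in `S`. Agent actions use `S₀ = ∅`, the exogenous template
`S₀ = {0}`. -/
theorem spOnly_regress (A : ActionTemplate L p) (j : Fin A.numVariants) (args : Fin p → RTerm L V)
    {S : Set V} {S₀ : Set (Fin p)} (hrel : ∀ r, (A.tvd j r).SpOnly (Sum.inl '' S₀))
    (hsp : ∀ q, (A.tvdSp j q).SpOnly (insert (Sum.inr ()) (Sum.inl '' S₀)))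
    (hargs : ∀ i ∈ S₀, ∃ v ∈ S, args i = RTerm.var v) {f : Diagram L V α} (hf : f.SpOnly S) :
    (A.regress j args f).SpOnly S := by
  refine hf.replace fun B hB => ?_
  cases B with
  | rel r t =>
    refine (hrel r).subst ?_
    rintro _ ⟨i, hi, rfl⟩
    exact hargs i hi
  | sp q t =>
    refine (hsp q).subst ?_
    rintro _ (rfl | ⟨i, hi, rfl⟩)
    · exact hB
    · exact hargs i hi
  | eq t₁ t₂ => exact ⟨trivial, trivial, trivial⟩

end ActionTemplate

/-! ### Aggregated expressions -/

namespace MaxAvg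

variable {L : RelSig} {p : ℕ} {D : Type*}

section Semantics

variable [Fintype D]

theorem avgAt_le_eval (V : MaxAvg L p) (a : Fin p → D) (x : Fin V.k → D) (I : Interp L D) :
    V.avgAt a x I ≤ V.eval a I :=
  le_ciSup (f := fun x => V.avgAt a x I) (Set.finite_range _).bddAbove x

theorem avgAt_zero (a : Fin p → D) (x : Fin (zero : MaxAvg L p).k → D) (I : Interp L D) :
    (zero : MaxAvg L p).avgAt a x I = 0 := by
  simp [avgAt, zero, Diagram.eval]

theorem avgAt_scale (c : ℝ≥0) (V : MaxAvg L p) (a : Fin p → D) (x : Fin V.k → D)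
    (I : Interp L D) : (scale c V).avgAt a x I = c * V.avgAt a x I := by
  simp only [avgAt, scale, Diagram.eval_map, ← Finset.mul_sum, mul_div_assoc]

/-- Sharing `y` turns the sum of two averages into one average, while standardizing apart lets the
two halves of `z` be chosen independently. -/
theorem avgAt_add (V W : MaxAvg L p) (a : Fin p → D) (z : Fin (V.k + W.k) → D) (I : Interp L D) :
    (V.add W).avgAt a z I =
      V.avgAt a (fun i => z (Fin.castAdd _ i)) I + W.avgAt a (fun i => z (Fin.natAdd _ i)) I := by
  simp only [avgAt, add, Diagram.eval_apply, Diagram.eval_rename, ← add_div,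
    ← Finset.sum_add_distrib]
  refine congrArg (· / _) (Finset.sum_congr rfl fun y _ => ?_)
  congr 2 <;> funext v <;> cases v <;> rfl

theorem avgAt_lift (V : MaxAvg L 0) (a : Fin p → D) (x : Fin V.k → D) (I : Interp L D) :
    V.lift.avgAt a x I = V.avgAt Fin.elim0 x I := by
  simp only [avgAt, lift, Diagram.eval_rename]
  refine congrArg (· / _) (Finset.sum_congr rfl fun y _ => ?_)
  congr 1
  funext v
  cases v with
  | free i => exact i.elim0
  | mx i => rfl
  | av => rfl

theorem avgAt_objMax (V : MaxAvg L p) (z : Fin (p + V.k) → D) (I : Interp L D) :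
    V.objMax.avgAt Fin.elim0 z I =
      V.avgAt (fun i => z (Fin.castAdd _ i)) (fun i => z (Fin.natAdd _ i)) I := by
  simp only [avgAt, objMax, Diagram.eval_rename]
  refine congrArg (· / _) (Finset.sum_congr rfl fun y _ => ?_)
  congr 1
  funext v
  cases v <;> rfl

theorem avgAt_add_append (V W : MaxAvg L p) (a : Fin p → D) (x : Fin V.k → D) (w : Fin W.k → D)
    (I : Interp L D) :
    (V.add W).avgAt a (Fin.append x w) I = V.avgAt a x I + W.avgAt a w I := by
  rw [avgAt_add]
  simp only [Fin.append_left, Fin.append_right]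

theorem avgAt_objMax_append (V : MaxAvg L p) (a : Fin p → D) (x : Fin V.k → D) (I : Interp L D) :
    V.objMax.avgAt Fin.elim0 (Fin.append a x) I = V.avgAt a x I := by
  rw [avgAt_objMax]
  simp only [Fin.append_left, Fin.append_right]

open Classical in
theorem avgAt_max (V W : MaxAvg L p) (a : Fin p → D) (z : Fin (2 + Nat.max V.k W.k) → D)
    (I : Interp L D) :
    (V.max W).avgAt a z I =
      if z (Fin.castAdd _ 0) = z (Fin.castAdd _ 1) then
        V.avgAt a (fun i => z (Fin.natAdd 2 (Fin.castLE (Nat.le_max_left _ _) i))) I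
      else W.avgAt a (fun i => z (Fin.natAdd 2 (Fin.castLE (Nat.le_max_right _ _) i))) I := by
  simp only [avgAt, max, Diagram.eval, RAtom.Holds, RTerm.eval, AggVar.assign,
    Diagram.eval_rename]
  split
  all_goals
    refine congrArg (· / _) (Finset.sum_congr rfl fun y _ => ?_)
    congr 1
    funext v
    cases v <;> rfl

/-- The test `z₁ = z₂` compares objects, not states, so `z` selects one of the expressions once and
for all. The order of quantifiers, with `I` last, is what allows the choice to be carried through
regression to later states. -/
theorem exists_avgAt_of_maxAll (n : ℕ) (Q : Fin (n + 1) → MaxAvg L p) (a : Fin p → D)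
    (z : Fin (maxAll n Q).k → D) :
    ∃ (t : Fin (n + 1)) (x : Fin (Q t).k → D),
      ∀ I, (maxAll n Q).avgAt a z I = (Q t).avgAt a x I := by
  induction n with
  | zero => exact ⟨0, z, fun _ => rfl⟩
  | succ n ih =>
    by_cases h : z (Fin.castAdd _ 0) = z (Fin.castAdd _ 1)
    · exact ⟨0, _, fun I => (avgAt_max _ _ a z I).trans (if_pos h)⟩
    · obtain ⟨t, x, hx⟩ := ih (fun i => Q i.succ)
        (fun i => z (Fin.natAdd 2 (Fin.castLE (Nat.le_max_right _ _) i)))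
      exact ⟨t.succ, x, fun I => ((avgAt_max _ _ a z I).trans (if_neg h)).trans (hx I)⟩

theorem exists_max_avgAt_eq_left (V W : MaxAvg L p) [Nonempty D] (a : Fin p → D)
    (x : Fin V.k → D) : ∃ z, ∀ I, (V.max W).avgAt a z I = V.avgAt a x I := by
  obtain ⟨d⟩ := ‹Nonempty D›
  -- Equal selectors pick the left branch; the variables beyond the first `V.k` do not occur in it
  -- and get the dummy value `d`.
  refine ⟨Fin.append (fun _ => d) (fun i => if h : i.1 < V.k then x ⟨i, h⟩ else d), fun I => ?_⟩
  rw [avgAt_max, if_pos (by rw [Fin.append_left, Fin.append_left])]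
  congr 1
  funext i
  rw [Fin.append_right]
  exact dif_pos i.2

/-- The right branch is reached only by two different selectors; this is where a second object is
needed. -/
theorem exists_max_avgAt_eq_right (V W : MaxAvg L p) [Nontrivial D] (a : Fin p → D)
    (x : Fin W.k → D) : ∃ z, ∀ I, (V.max W).avgAt a z I = W.avgAt a x I := by
  obtain ⟨d, e, hde⟩ := exists_pair_ne D
  refine ⟨Fin.append ![d, e] (fun i => if h : i.1 < W.k then x ⟨i, h⟩ else d), fun I => ?_⟩
  rw [avgAt_max, if_neg (by rw [Fin.append_left, Fin.append_left]; exact hde)]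
  congr 1
  funext i
  rw [Fin.append_right]
  exact dif_pos i.2

theorem exists_maxAll_avgAt_eq (n : ℕ) (hD : n = 0 ∨ Nontrivial D)
    (Q : Fin (n + 1) → MaxAvg L p) (a : Fin p → D) (t : Fin (n + 1)) (x : Fin (Q t).k → D) :
    ∃ z, ∀ I, (maxAll n Q).avgAt a z I = (Q t).avgAt a x I := by
  induction n with
  | zero =>
    obtain rfl : t = 0 := Fin.fin_one_eq_zero t
    exact ⟨x, fun _ => rfl⟩
  | succ n ih =>
    have : Nontrivial D := hD.resolve_left n.succ_ne_zero
    cases t using Fin.cases with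
    | zero => exact exists_max_avgAt_eq_left _ _ a x
    | succ t =>
      obtain ⟨z, hz⟩ := ih (Or.inr this) (fun i => Q i.succ) t x
      obtain ⟨z', hz'⟩ := exists_max_avgAt_eq_right (Q 0) (maxAll n fun i => Q i.succ) a z
      exact ⟨z', fun I => (hz' I).trans (hz I)⟩

/-- The summands of a sum are instantiated separately. -/
theorem exists_avgAt_of_sum (n : ℕ) (F : Fin n → MaxAvg L p) (a : Fin p → D)
    (z : Fin ((List.ofFn F).foldr add zero).k → D) :
    ∃ x : ∀ j, Fin (F j).k → D,
      ∀ I, ((List.ofFn F).foldr add zero).avgAt a z I = ∑ j, (F j).avgAt a (x j) I := by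
  induction n with
  | zero =>
    refine ⟨fun j => j.elim0, fun I => ?_⟩
    rw [Fin.sum_univ_zero]
    exact avgAt_zero a z I
  | succ n ih =>
    -- The type of `z` mentions the sum, so the sum is abstracted before the list is unfolded.
    generalize hG : (List.ofFn F).foldr add zero = G at z
    rw [List.ofFn_succ, List.foldr_cons] at hG
    subst hG
    obtain ⟨x, hx⟩ := ih (fun j => F j.succ) (fun i => z (Fin.natAdd _ i))
    refine ⟨Fin.cons (fun i => z (Fin.castAdd _ i)) x, fun I => ?_⟩
    rw [Fin.sum_univ_succ]
    simp only [Fin.cons_zero, Fin.cons_succ]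
    rw [← hx I]
    exact avgAt_add _ _ a z I

theorem exists_sum_avgAt_eq (n : ℕ) (F : Fin n → MaxAvg L p) (a : Fin p → D)
    (x : ∀ j, Fin (F j).k → D) :
    ∃ z, ∀ I, ((List.ofFn F).foldr add zero).avgAt a z I = ∑ j, (F j).avgAt a (x j) I := by
  induction n with
  | zero =>
    refine ⟨Fin.elim0, fun I => ?_⟩
    rw [Fin.sum_univ_zero]
    exact avgAt_zero a _ I
  | succ n ih =>
    obtain ⟨z, hz⟩ := ih (fun j => F j.succ) (fun j => x j.succ)
    rw [List.ofFn_succ, List.foldr_cons]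
    refine ⟨Fin.append (x 0) z, fun I => ?_⟩
    rw [Fin.sum_univ_succ, ← hz I]
    exact avgAt_add_append _ _ a _ _ I

end Semantics

/-! ### Special predicates in aggregated expressions. -/

theorem spOnly_maxAll (n : ℕ)
    (Q : Fin (n + 1) → MaxAvg L p) (hQ : ∀ t, (Q t).body.SpOnly {AggVar.av}) :
    (maxAll n Q).body.SpOnly {AggVar.av} := by
  induction n with
  | zero => exact hQ 0
  | succ n ih =>
    refine ⟨trivial, (hQ 0).rename ?_, (ih _ fun t => hQ t.succ).rename ?_⟩ <;>
    · rintro _ rfl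
      rfl

theorem spOnly_add {V W : MaxAvg L p} (hV : V.body.SpOnly {AggVar.av})
    (hW : W.body.SpOnly {AggVar.av}) : (V.add W).body.SpOnly {AggVar.av} := by
  refine (hV.rename ?_).apply _ (hW.rename ?_) <;>
  · rintro _ rfl
    rfl

theorem spOnly_sum (l : List (MaxAvg L p)) (hl : ∀ V ∈ l, V.body.SpOnly {AggVar.av}) :
    (l.foldr add zero).body.SpOnly {AggVar.av} := by
  induction l with
  | nil => trivial
  | cons V l ih =>
    exact spOnly_add (hl V List.mem_cons_self) (ih fun W hW => hl W (List.mem_cons_of_mem V hW))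

theorem spOnly_lift {V : MaxAvg L 0} (hV : V.body.SpOnly {AggVar.av}) :
    (V.lift : MaxAvg L p).body.SpOnly {AggVar.av} := by
  refine hV.rename ?_
  rintro _ rfl
  rfl

theorem spOnly_objMax {V : MaxAvg L p} (hV : V.body.SpOnly {AggVar.av}) :
    V.objMax.body.SpOnly {AggVar.av} := by
  refine hV.rename ?_
  rintro _ rfl
  rfl

end MaxAvg

namespace ServiceDomain

variable {L : RelSig} {M : ServiceDomain L}

/-! ### The special predicates in the expressions of the template method -/

theorem spOnly_regressVariant (hpre : M.SpPreconditions) {V : MaxAvg L 0}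
    (hV : V.body.SpOnly {AggVar.av}) (t : Fin (M.n + 1)) (j : Fin (M.agent t).numVariants) :
    (M.regressVariant V t j).body.SpOnly {AggVar.av} := by
  refine ((hpre.agentProb t j).rename fun v hv => hv.elim).apply _ ?_
  refine (M.agent t).spOnly_regress j _ (S₀ := ∅) ?_ ?_ (fun i hi => hi.elim)
    (MaxAvg.spOnly_lift hV)
  · simpa using hpre.agentRel t j
  · simpa using hpre.agentSp t j

theorem spOnly_sdp1 (hpre : M.SpPreconditions) (hreward : M.RewardForm) {V : MaxAvg L 0}
    (hV : V.body.SpOnly {AggVar.av}) : (M.sdp1 V).body.SpOnly {AggVar.av} := by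
  refine MaxAvg.spOnly_maxAll _ _ fun t => MaxAvg.spOnly_objMax ?_
  refine MaxAvg.spOnly_add (MaxAvg.spOnly_lift hreward) ?_
  refine Diagram.SpOnly.map _ (MaxAvg.spOnly_sum _ ?_)
  intro W hW
  obtain ⟨j, rfl⟩ := (List.mem_ofFn' _ _).1 hW
  exact spOnly_regressVariant hpre hV t j

/-- Grounding turns `y` into the parameter of `E`, so the atoms `sp(a)` of the expression and those
in the preconditions of `E(a)` have the same argument. -/
theorem spOnly_exoSum (hpre : M.SpPreconditions) {V : MaxAvg L 0}
    (hV : V.body.SpOnly {AggVar.av}) : (M.exoSum V).SpOnly {AggVar.free 0} := by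
  have key : ∀ l : List (Diagram L (AggVar 1 V.k) ℝ≥0), (∀ f ∈ l, f.SpOnly {AggVar.free 0}) →
      (l.foldr (fun f g => Diagram.apply (fun v w => v + w) f g) (Diagram.leaf 0)).SpOnly
        {AggVar.free 0} := by
    intro l hl
    induction l with
    | nil => trivial
    | cons f l ih =>
      exact (hl f List.mem_cons_self).apply _ (ih fun g hg => hl g (List.mem_cons_of_mem f hg))
  refine key _ fun f hf => ?_
  obtain ⟨j, rfl⟩ := (List.mem_ofFn' _ _).1 hf
  refine ((hpre.exoProb j).rename ?_).apply _ ?_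
  · rintro _ rfl
    rfl
  · refine M.exo.spOnly_regress j _ (S₀ := {0}) ?_ ?_ ?_ (hV.rename ?_)
    · simpa using hpre.exoRel j
    · simpa [Set.pair_comm] using hpre.exoSp j
    · rintro _ rfl
      exact ⟨_, rfl, rfl⟩
    · rintro _ rfl
      rfl

theorem spOnly_sdp2 (hpre : M.SpPreconditions) {V : MaxAvg L 0}
    (hV : V.body.SpOnly {AggVar.av}) : (M.sdp2 V).body.SpOnly {AggVar.av} := by
  refine (spOnly_exoSum hpre hV).rename ?_
  rintro _ rfl
  rfl

/-- This invariant makes `avgAt_sdp2` applicable at every iteration. -/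
theorem spOnly_template (hpre : M.SpPreconditions) (hreward : M.RewardForm) (m : ℕ) :
    (M.template m).body.SpOnly {AggVar.av} := by
  induction m with
  | zero => exact hreward
  | succ m ih => exact spOnly_sdp1 hpre hreward (spOnly_sdp2 hpre ih)

/-! ### Expectations -/

variable {D : Type*} [Fintype D]

theorem exoExpect_mono {f g : Interp L D → ℝ≥0} (h : ∀ I, f I ≤ g I) (I : Interp L D) :
    M.exoExpect f I ≤ M.exoExpect g I :=
  Finset.sum_le_sum fun _ _ => mul_le_mul_right (h _) _

theorem expect_sum {ι : Type*} (s : Finset ι) (c : ι → ℝ≥0) (f : ι → Interp L D → ℝ≥0)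
    (a : M.GroundAction D) (I : Interp L D) :
    M.expect a (fun J => ∑ i ∈ s, c i * f i J) I = ∑ i ∈ s, c i * M.expect a (f i) I := by
  simp only [expect, exoExpect, Finset.mul_sum]
  conv_rhs => rw [Finset.sum_comm]
  refine Finset.sum_congr rfl fun j _ => ?_
  conv_rhs => rw [Finset.sum_comm]
  refine Finset.sum_congr rfl fun β _ => Finset.sum_congr rfl fun i _ => ?_
  ring

/-- The expectation of a function of one coordinate of a vector of independent choices. -/
theorem sum_prod_mul_apply {ι κ : Type*} [Fintype ι] [DecidableEq ι] [Fintype κ]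
    (w : ι → κ → ℝ≥0) (hw : ∀ i, ∑ j, w i j = 1) (i₀ : ι) (g : κ → ℝ≥0) :
    ∑ β : ι → κ, (∏ i, w i (β i)) * g (β i₀) = ∑ j, w i₀ j * g j := by
  -- Absorbing `g` into the factor at `i₀` lets the sum over `β` factorize; every other factor then
  -- sums to `1`.
  have h : ∀ β : ι → κ, (∏ i, w i (β i)) * g (β i₀) =
      ∏ i, w i (β i) * (if i = i₀ then g (β i) else 1) := by
    intro β
    rw [Finset.prod_mul_distrib, Finset.prod_ite_eq' Finset.univ i₀ (fun i => g (β i)),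
      if_pos (Finset.mem_univ _)]
  simp only [h]
  rw [← Fintype.prod_sum (fun i j => w i j * (if i = i₀ then g j else 1)),
    Finset.prod_eq_single i₀]
  · simp
  · intro i _ hi
    simp [hi, hw]
  · simp

/-! ### Semantics of the template method -/

/-- The template step computes, for fixed objects, the exact expectation over the simultaneous
exogenous events. -/
theorem avgAt_sdp2 (hprob : M.Stochastic D) (hlocal : M.ExoLocal D) {V : MaxAvg L 0}
    (hV : V.body.SpOnly {AggVar.av}) (x : Fin V.k → D) (I : Interp L D) :
    (M.sdp2 V).avgAt Fin.elim0 x I = M.exoExpect (V.avgAt Fin.elim0 x) I := by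
  classical
  have hsum : ∀ (l : List (Diagram L (AggVar 1 V.k) ℝ≥0)) (ζ : AggVar 1 V.k → D),
      (l.foldr (fun f g => Diagram.apply (fun v w => v + w) f g) (Diagram.leaf 0)).eval I ζ =
        (l.map fun f => f.eval I ζ).sum := by
    intro l ζ
    induction l with
    | nil => rfl
    | cons f l ih => simp only [List.foldr_cons, Diagram.eval_apply, ih, List.map_cons,
        List.sum_cons]
  have hbody : ∀ y : D, (M.sdp2 V).body.eval I (AggVar.assign Fin.elim0 x y) =
      ∑ j, M.exo.probAt j (fun _ => y) I *
        V.body.eval (M.exo.next j (fun _ => y) I) (AggVar.assign Fin.elim0 x y) := by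
    intro y
    simp only [sdp2, exoSum, Diagram.eval_rename, hsum, List.map_ofFn, List.sum_ofFn,
      Function.comp_def, Diagram.eval_apply, ActionTemplate.eval_regress, ground, RTerm.eval,
      AggVar.assign]
    refine Finset.sum_congr rfl fun j _ => ?_
    congr 2
    funext v
    cases v with
    | free i => exact i.elim0
    | mx i => rfl
    | av => rfl
  -- For a fixed `y` the body cannot distinguish the simultaneous events from `E(y)` alone, so only
  -- the coordinate `β y` survives.
  have hmarg : ∀ y : D, ∑ β : D → Fin M.exo.numVariants,
      (∏ i : D, M.exo.probAt (β i) (fun _ => i) I) *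
        V.body.eval (M.exoNext β I) (AggVar.assign Fin.elim0 x y) =
      (M.sdp2 V).body.eval I (AggVar.assign Fin.elim0 x y) := by
    intro y
    rw [hbody, ← sum_prod_mul_apply (fun i j => M.exo.probAt j (fun _ => i) I)
      (fun i => hprob.exo i I) y]
    refine Finset.sum_congr rfl fun β _ => congrArg _ ?_
    refine Diagram.eval_congr_of_spOnly (I := M.exoNext β I)
      (J := M.exo.next (β y) (fun _ => y) I) (S := {AggVar.av}) rfl (hlocal.rel (β y) y I).symm ?_ _ hV
    rintro _ rfl q
    exact Iff.rfl
  refine (congrArg (· / _) ((Finset.sum_congr rfl fun y _ => (hmarg y).symm).trans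
    Finset.sum_comm)).trans ?_
  rw [Finset.sum_div]
  refine Finset.sum_congr rfl fun β _ => ?_
  rw [← Finset.mul_sum, mul_div_assoc]
  rfl

theorem avgAt_regressVariant (V : MaxAvg L 0) (t : Fin (M.n + 1))
    (j : Fin (M.agent t).numVariants) (a : Fin (M.params t) → D) (x : Fin V.k → D)
    (I : Interp L D) :
    (M.regressVariant V t j).avgAt a x I =
      (M.agent t).probAt j a I * V.avgAt Fin.elim0 x ((M.agent t).next j a I) := by
  rw [← MaxAvg.avgAt_lift V a x]
  simp only [MaxAvg.avgAt, ← mul_div_assoc, Finset.mul_sum]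
  refine congrArg (· / _) (Finset.sum_congr rfl fun y _ => ?_)
  exact (Diagram.eval_apply _ _ _ _ _).trans (congrArg₂ (· * ·) (Diagram.eval_rename _ _ _ _)
    (ActionTemplate.eval_regress _ _ _ _ _ _))

/-- Objects for the `max` variables of a symbolic backup are a ground action, objects for the
reward, and objects for the regressed expression that depend on the variant. -/
theorem exists_avgAt_of_sdp1 (V : MaxAvg L 0) (z : Fin (M.sdp1 V).k → D) :
    ∃ (a : M.GroundAction D) (x₀ : Fin M.reward.k → D)
      (x : Fin (M.agent a.1).numVariants → Fin V.k → D), ∀ I,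
      (M.sdp1 V).avgAt Fin.elim0 z I = M.reward.avgAt Fin.elim0 x₀ I +
        M.γ * ∑ j, (M.agent a.1).probAt j a.2 I *
          V.avgAt Fin.elim0 (x j) ((M.agent a.1).next j a.2 I) := by
  obtain ⟨t, y, hy⟩ := MaxAvg.exists_avgAt_of_maxAll M.n (fun t => (M.qFun V t).objMax) _ z
  let a : Fin (M.params t) → D := fun i => y (Fin.castAdd _ i)
  let w : Fin (M.qFun V t).k → D := fun i => y (Fin.natAdd _ i)
  obtain ⟨x, hx⟩ := MaxAvg.exists_avgAt_of_sum _ (fun j => M.regressVariant V t j) a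
    (fun i => w (Fin.natAdd _ i))
  refine ⟨⟨t, a⟩, fun i => w (Fin.castAdd _ i), x, fun I => ?_⟩
  refine (hy I).trans ((MaxAvg.avgAt_objMax _ y I).trans ((MaxAvg.avgAt_add _ _ a w I).trans ?_))
  refine congrArg₂ (· + ·) (MaxAvg.avgAt_lift _ _ _ _)
    ((MaxAvg.avgAt_scale _ _ _ _ _).trans (congrArg (_ * ·) ((hx I).trans ?_)))
  exact Finset.sum_congr rfl fun j _ => avgAt_regressVariant V t j a (x j) I

theorem exists_qFun_avgAt_eq (V : MaxAvg L 0) (t : Fin (M.n + 1)) (a : Fin (M.params t) → D)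
    (x₀ : Fin M.reward.k → D) (x : Fin (M.agent t).numVariants → Fin V.k → D) :
    ∃ v : Fin (M.qFun V t).k → D, ∀ I,
      (M.qFun V t).avgAt a v I = M.reward.avgAt Fin.elim0 x₀ I +
        M.γ * ∑ j, (M.agent t).probAt j a I *
          V.avgAt Fin.elim0 (x j) ((M.agent t).next j a I) := by
  obtain ⟨w, hw⟩ := MaxAvg.exists_sum_avgAt_eq _ (fun j => M.regressVariant V t j) a x
  refine ⟨Fin.append (m := (M.reward.lift (p := M.params t)).k) x₀ w, fun I => ?_⟩
  have hsum := Finset.sum_congr rfl fun j (_ : j ∈ Finset.univ) =>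
    avgAt_regressVariant V t j a (x j) I
  rw [← hsum, ← hw I, ← MaxAvg.avgAt_lift M.reward a x₀ I, ← MaxAvg.avgAt_scale]
  exact MaxAvg.avgAt_add_append _ _ a _ _ I

/-- The converse of `exists_avgAt_of_sdp1`; `hD` ensures that the nested binary maxima can select
every template. -/
theorem exists_sdp1_avgAt_eq (hD : M.n = 0 ∨ Nontrivial D) (V : MaxAvg L 0)
    (a : M.GroundAction D) (x₀ : Fin M.reward.k → D)
    (x : Fin (M.agent a.1).numVariants → Fin V.k → D) :
    ∃ z : Fin (M.sdp1 V).k → D, ∀ I,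
      (M.sdp1 V).avgAt Fin.elim0 z I = M.reward.avgAt Fin.elim0 x₀ I +
        M.γ * ∑ j, (M.agent a.1).probAt j a.2 I *
          V.avgAt Fin.elim0 (x j) ((M.agent a.1).next j a.2 I) := by
  obtain ⟨t, a⟩ := a
  obtain ⟨v, hv⟩ := exists_qFun_avgAt_eq V t a x₀ x
  obtain ⟨z, hz⟩ := MaxAvg.exists_maxAll_avgAt_eq M.n hD (fun t => (M.qFun V t).objMax)
    Fin.elim0 t (Fin.append a v)
  exact ⟨z, fun I => (hz I).trans ((MaxAvg.avgAt_objMax_append _ a v I).trans (hv I))⟩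

/-! ### Straight-line plans and the comparison of values. -/

theorem reward_value_eq_avgAt (hk : M.reward.k = 0) (x : Fin M.reward.k → D) :
    M.reward.value = M.reward.avgAt Fin.elim0 x := by
  have : IsEmpty (Fin M.reward.k) := by rw [hk]; infer_instance
  funext I
  exact (ciSup_unique (s := fun x => M.reward.avgAt Fin.elim0 x I)).trans
    (congrArg (fun x => M.reward.avgAt Fin.elim0 x I) (Subsingleton.elim _ _))

theorem slArgValue_eq_slValue (hk : M.reward.k = 0) (m : ℕ) (I : Interp L D) :
    M.slArgValue m I = M.slValue m I := by
  have : IsEmpty (Fin M.reward.k) := by rw [hk]; infer_instance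
  refine iSup_congr fun plan => ?_
  rw [ciSup_unique]
  congr 1
  funext t
  exact (reward_value_eq_avgAt hk _).symm

theorem planValue_le_slArgValue (m : ℕ) (plan : Fin m → M.GroundAction D)
    (x : Fin (m + 1) → (Fin M.reward.k → D)) (I : Interp L D) :
    M.planValue m (fun t => M.reward.avgAt Fin.elim0 (x t)) plan I ≤ M.slArgValue m I :=
  (le_ciSup (f := fun x : Fin (m + 1) → (Fin M.reward.k → D) =>
      M.planValue m (fun t => M.reward.avgAt Fin.elim0 (x t)) plan I)
      (Set.finite_range _).bddAbove x).trans
    (le_ciSup (f := fun plan : Fin m → M.GroundAction D =>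
      ⨆ x : Fin (m + 1) → (Fin M.reward.k → D),
        M.planValue m (fun t => M.reward.avgAt Fin.elim0 (x t)) plan I)
      (Set.finite_range _).bddAbove plan)

instance [Nonempty D] : Nonempty (M.GroundAction D) :=
  ⟨⟨0, fun _ => Classical.arbitrary D⟩⟩

section

variable (hprob : M.Stochastic D) (hlocal : M.ExoLocal D) (hpre : M.SpPreconditions)
  (hreward : M.RewardForm)

include hprob hlocal hpre hreward

/-- Every straight-line plan that fixes the objects in the reward is an instance of the expression
computed by the template method. -/
theorem exists_template_avgAt_eq_planValue (hD : M.n = 0 ∨ Nontrivial D) (m : ℕ)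
    (plan : Fin m → M.GroundAction D) (x : Fin (m + 1) → (Fin M.reward.k → D)) :
    ∃ z : Fin (M.template m).k → D, (M.template m).avgAt Fin.elim0 z =
      M.planValue m (fun t => M.reward.avgAt Fin.elim0 (x t)) plan := by
  induction m with
  | zero => exact ⟨x 0, rfl⟩
  | succ m ih =>
    obtain ⟨z, hz⟩ := ih (fun i => plan i.succ) (fun i => x i.succ)
    -- A plan fixed in advance continues in the same way after every variant, hence the constant
    -- choice `z`.
    obtain ⟨w, hw⟩ := exists_sdp1_avgAt_eq hD (M.sdp2 (M.template m)) (plan 0) (x 0) (fun _ => z)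
    refine ⟨w, funext fun I => (hw I).trans ?_⟩
    simp only [planValue, expect, ← hz]
    refine congrArg (fun r : ℝ≥0 => _ + M.γ * r) (Finset.sum_congr rfl fun j _ => congrArg (_ * ·) ?_)
    exact avgAt_sdp2 hprob hlocal (spOnly_template hpre hreward m) z _

theorem slArgValue_le_template [Nonempty D] (hD : M.n = 0 ∨ Nontrivial D) (m : ℕ)
    (I : Interp L D) : M.slArgValue m I ≤ (M.template m).value I := by
  refine ciSup_le fun plan => ciSup_le fun x => ?_
  obtain ⟨z, hz⟩ := exists_template_avgAt_eq_planValue hprob hlocal hpre hreward hD m plan x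
  rw [← hz]
  exact MaxAvg.avgAt_le_eval _ _ z I

/-- For one deterministic template, every instance of the expression computed by the template
method is a straight-line plan. -/
theorem exists_planValue_eq_template_avgAt (hdet : M.SingleDeterministic) (m : ℕ)
    (z : Fin (M.template m).k → D) :
    ∃ (plan : Fin m → M.GroundAction D) (x : Fin (m + 1) → (Fin M.reward.k → D)),
      (M.template m).avgAt Fin.elim0 z =
        M.planValue m (fun t => M.reward.avgAt Fin.elim0 (x t)) plan := by
  induction m with
  | zero => exact ⟨Fin.elim0, fun _ => z, rfl⟩
  | succ m ih =>
    obtain ⟨a, x₀, w, hw⟩ := exists_avgAt_of_sdp1 (M.sdp2 (M.template m)) z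
    have h1 := hdet.2 a.1
    have : Subsingleton (Fin (M.agent a.1).numVariants) := by rw [h1]; infer_instance
    -- The only variant; its instance `w j₀` is the whole continuation, so nothing is left to branch
    -- on.
    let j₀ : Fin (M.agent a.1).numVariants := ⟨0, by omega⟩
    obtain ⟨plan, x, hx⟩ := ih (w j₀)
    refine ⟨Fin.cons a plan, Fin.cons x₀ x, funext fun I => (hw I).trans ?_⟩
    simp only [planValue, expect, Fin.cons_zero, Fin.cons_succ, ← hx]
    refine congrArg (fun r : ℝ≥0 => _ + M.γ * r) (Finset.sum_congr rfl fun j _ => congrArg (_ * ·) ?_)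
    obtain rfl : j = j₀ := Subsingleton.elim _ _
    exact avgAt_sdp2 hprob hlocal (spOnly_template hpre hreward m) _ _

theorem template_le_slArgValue [Nonempty D] (hdet : M.SingleDeterministic) (m : ℕ)
    (I : Interp L D) : (M.template m).value I ≤ M.slArgValue m I := by
  refine ciSup_le fun z => ?_
  obtain ⟨plan, x, h⟩ := exists_planValue_eq_template_avgAt hprob hlocal hpre hreward hdet m z
  rw [h]
  exact planValue_le_slArgValue m plan x I

/-- An instance commits to its continuation before the exogenous events are seen. Replacing it by
the maximum in each resulting state only increases the expectation. -/
theorem template_le_optValue [Nonempty D] (m : ℕ) (I : Interp L D) :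
    (M.template m).value I ≤ M.optValue m I := by
  induction m generalizing I with
  | zero => exact le_rfl
  | succ m ih =>
    refine ciSup_le fun z => ?_
    obtain ⟨a, x₀, w, hw⟩ := exists_avgAt_of_sdp1 (M.sdp2 (M.template m)) z
    refine (hw I).le.trans (le_trans ?_ (le_ciSup (f := fun a : M.GroundAction D =>
      M.reward.value I + M.γ * M.expect a (M.optValue m) I) (Set.finite_range _).bddAbove a))
    refine add_le_add (MaxAvg.avgAt_le_eval _ _ _ _) (mul_le_mul_right ?_ _)
    refine Finset.sum_le_sum fun j _ => mul_le_mul_right ?_ _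
    refine (avgAt_sdp2 hprob hlocal (spOnly_template hpre hreward m) (w j) _).le.trans ?_
    exact exoExpect_mono (fun J => (MaxAvg.avgAt_le_eval _ _ _ _).trans (ih J)) _

end

/-- The optimal value with `m` steps to go is attained by a policy. -/
theorem exists_policy_optValue [Nonempty D] (m : ℕ) :
    ∃ π : ℕ → Interp L D → M.GroundAction D, ∀ I,
      M.optValue m I = ∑ t ∈ Finset.range (m + 1), M.γ ^ t * M.rewardAt t π I := by
  induction m with
  | zero =>
    -- With no steps to go the policy is never consulted.
    refine ⟨fun _ _ => Classical.arbitrary _, fun I => ?_⟩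
    simp [optValue, rewardAt]
  | succ m ih =>
    obtain ⟨π, hπ⟩ := ih
    have hmax : ∀ I, ∃ a : M.GroundAction D,
        M.reward.value I + M.γ * M.expect a (M.optValue m) I = M.optValue (m + 1) I :=
      fun I => exists_eq_ciSup_of_finite
    choose a ha using hmax
    -- The maximizing action `a` is played at time `0`, and `π` is followed with time shifted by
    -- one.
    refine ⟨fun t => Nat.casesOn t a π, fun I => ?_⟩
    rw [← ha I, Finset.sum_range_succ', add_comm, funext hπ, expect_sum, Finset.mul_sum]
    simp only [pow_succ', mul_assoc, rewardAt, pow_zero, one_mul]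
    rfl

/-- The policy attaining `optValue` is simply run forever: its first `m + 1` rewards are a partial
sum of a series with nonnegative terms in `ℝ≥0∞`. -/
theorem optValue_le_optimalValue [Nonempty D] (m : ℕ) (I : Interp L D) :
    ((M.optValue m I : ℝ≥0) : ℝ≥0∞) ≤ M.optimalValue I := by
  obtain ⟨π, hπ⟩ := M.exists_policy_optValue (D := D) m
  rw [hπ I, ENNReal.ofNNReal_finsetSum]
  exact (ENNReal.sum_le_tsum _).trans
    (le_iSup (fun π : ℕ → Interp L D → M.GroundAction D =>
      ∑' t : ℕ, ((M.γ ^ t * M.rewardAt t π I : ℝ≥0) : ℝ≥0∞)) π)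

end ServiceDomain

theorem mainTheorem5 {L : RelSig} (M : ServiceDomain L) (hγ : M.γ < 1)
    {D : Type*} [Fintype D] [Nonempty D]
    (hprob : M.Stochastic D) (hlocal : M.ExoLocal D) (hpre : M.SpPreconditions)
    (hreward : M.RewardForm) :
    (M.SingleDeterministic → ∀ (m : ℕ) (I : Interp L D),
      (M.template m).value I = M.slArgValue m I ∧
      (M.reward.k = 0 → (M.template m).value I = M.slValue m I)) ∧
    ((M.n = 0 ∨ Nontrivial D) → ∀ (m : ℕ) (I : Interp L D),
      M.slArgValue m I ≤ (M.template m).value I ∧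
      (M.reward.k = 0 → M.slValue m I ≤ (M.template m).value I)) ∧
    (∀ (m : ℕ) (I : Interp L D),
      (M.template m).value I ≤ M.optValue m I ∧
      ((M.optValue m I : ℝ≥0) : ℝ≥0∞) ≤ M.optimalValue I) := by
  have hle : (M.n = 0 ∨ Nontrivial D) → ∀ (m : ℕ) (I : Interp L D),
      M.slArgValue m I ≤ (M.template m).value I := fun hD =>
    ServiceDomain.slArgValue_le_template hprob hlocal hpre hreward hD
  refine ⟨fun hdet m I => ?_, fun hD m I => ?_, fun m I => ?_⟩
  · have heq : (M.template m).value I = M.slArgValue m I :=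
      le_antisymm (ServiceDomain.template_le_slArgValue hprob hlocal hpre hreward hdet m I)
        (hle (Or.inl hdet.1) m I)
    exact ⟨heq, fun hk => heq.trans (ServiceDomain.slArgValue_eq_slValue hk m I)⟩
  · exact ⟨hle hD m I, fun hk => (ServiceDomain.slArgValue_eq_slValue hk m I).ge.trans (hle hD m I)⟩
  · exact ⟨ServiceDomain.template_le_optValue hprob hlocal hpre hreward m I,
      ServiceDomain.optValue_le_optimalValue m I⟩
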